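/- A Ryser design of order $v$ and index $\lambda$ is a pair $\mathcal D=(X,L)$, where $X$ is a finite set of points and $L$ is a set of subsets of $X$ (the blocks), such that $|X|=|L|=v$, any two distinct blocks meet in exactly $\lambda$ points, every block has more than $\lambda$ points, and there are two blocks of different sizes. By the Ryser–Woodall theorem the points of a Ryser design have exactly two distinct replication numbers $r_1>r_2$ (the replication number of a point is the number of blocks containing it); put $\rho=\dfrac{r_1-1}{r_2-1}$. A symmetric $(v,k,\lambda')$ design is a pair $(X,\mathcal A)$ with $|X|=|\mathcal A|=v$ such that any two distinct blocks meet in exactly $\lambda'\ge 1$ points and every block has exactly $k>\lambda'$ points. A Ryser design $(X,L)$ is of Type-1 if there are a symmetric design $(X,\mathcal A)$ and a block $A\in\mathcal A$ such that $L=\{A\}\cup\{A\triangle B : B\in\mathcal A,\ B\ne A\}$. Theorem. Let $\mathcal D$ be a Ryser design of order $v$ and index $\lambda$ with $v\le\lambda^2+\lambda+1$. If $\rho=\lambda$ or $\rho=\lambda-1$, then $\mathcal D$ is of Type-1. -/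

import Mathlib

section RyserDesigns

variable {X : Type*} [Fintype X] [DecidableEq X]

/-- A design with point set `X` and block set `L` (a set of subsets of `X`) is a symmetric
`(v, k, l)` design. -/
structure IsSymmetricDesign (L : Finset (Finset X)) (v k l : ℕ) : Prop where
  card_points : Fintype.card X = v
  card_blocks : L.card = v
  one_le_index : 1 ≤ l
  card_inter : ∀ B₁ ∈ L, ∀ B₂ ∈ L, B₁ ≠ B₂ → (B₁ ∩ B₂).card = l
  card_block : ∀ B ∈ L, B.card = k
  index_lt : l < k

/-- A design with point set `X` and block set `L` is a Ryser design of order `v` and index `l`. -/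
structure IsRyserDesign (L : Finset (Finset X)) (v l : ℕ) : Prop where
  card_points : Fintype.card X = v
  card_blocks : L.card = v
  card_inter : ∀ B₁ ∈ L, ∀ B₂ ∈ L, B₁ ≠ B₂ → (B₁ ∩ B₂).card = l
  index_lt : ∀ B ∈ L, l < B.card
  exists_card_ne : ∃ B₁ ∈ L, ∃ B₂ ∈ L, B₁.card ≠ B₂.card

/-- The Ryser-Woodall complementation `L * A` of the design with block set `L` with respect to the
block `A`: the blocks are `A` itself and the symmetric differences `A ∆ B` for the blocks
`B ≠ A`. -/
def blockComplement (L : Finset (Finset X)) (A : Finset X) : Finset (Finset X) :=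
  insert A ((L.erase A).image fun B => symmDiff A B)

/-- A design is of Type-1 if it is obtained from a symmetric design by complementation with respect
to one of the blocks of that symmetric design. -/
def IsType1 (L : Finset (Finset X)) : Prop :=
  ∃ (S : Finset (Finset X)) (v k l : ℕ) (A : Finset X),
    IsSymmetricDesign S v k l ∧ A ∈ S ∧ L = blockComplement S A

/-- The replication number of the point `x`: the number of blocks that contain `x`. -/
def replication (L : Finset (Finset X)) (x : X) : ℕ :=
  (L.filter fun B => x ∈ B).card

/-- The larger replication number `r₁`. The points of a Ryser design have exactly two distinct
replication numbers `r₁ > r₂`, so `r₁` is the maximum of the replication numbers of the points. -/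
noncomputable def replicationOne (L : Finset (Finset X)) : ℕ :=
  ⨆ x : X, replication L x

/-- The smaller replication number `r₂`: the minimum of the replication numbers of the points. -/
noncomputable def replicationTwo (L : Finset (Finset X)) : ℕ :=
  ⨅ x : X, replication L x

/-- The rational number `ρ = (r₁ - 1) / (r₂ - 1)`. -/
noncomputable def rho (L : Finset (Finset X)) : ℚ :=
  ((replicationOne L : ℚ) - 1) / ((replicationTwo L : ℚ) - 1)

end RyserDesigns

/-! ### Point weights and the inverse of the incidence matrix. -/

section RyserWoodall

variable {X : Type*} [DecidableEq X]

/-! The incidence matrix is square and its Gram matrix on blocks is diagonal plus `l` times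
all-ones, so it has an explicit inverse. Reading that inverse on points (`IsRyserDesign.sum_pair`)
shows that the point weights satisfy one quadratic equation, hence take two values, and that
replication numbers are affine in them. When `ρ = n` is an integer, everything is expressed through
`n`, `g = r₂ - 1` and the set `E` of points of larger replication (`exists_hasIntegralRatio`).

Each block `B` then has one integer parameter, its deficit `s = l - |B ∩ E|`, with `|B| = 2l + (n -
1)s`. By `isType1_of_card_eq` it suffices that `s = 0` for all blocks but one. The bound on `v` and
the identity `card_mul` leave few values of `g` and `|E|`. In the main case of each ratio, `∑ 1`, `∑
s` and `∑ 1 / (l + (n - 1)s)` are known, and comparing the convex function `1 / (l + (n - 1)s)` with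
a chord gives a sum of nonnegative terms equal to zero. This forces `s ∈ {-1, 0}` when `n = l` and
`s ∈ {0, l}` when `n = l - 1`; the known `∑ s` then allows a single nonzero deficit. The remaining
cases are contradictory. -/

/-- The sum of `1 / (|B| - l)` over all blocks `B` through the point `x`. -/
def pointWeight (L : Finset (Finset X)) (l : ℕ) (x : X) : ℚ :=
  ∑ B ∈ L with x ∈ B, 1 / ((B.card : ℚ) - l)

/-- The sum of `1 / (|B| - l)` over all blocks `B`. -/
def totalWeight (L : Finset (Finset X)) (l : ℕ) : ℚ :=
  ∑ B ∈ L, 1 / ((B.card : ℚ) - l)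

theorem sum_sum_filter_mem (L : Finset (Finset X)) (T : Finset X) (f : Finset X → ℚ) :
    ∑ x ∈ T, ∑ B ∈ L with x ∈ B, f B = ∑ B ∈ L, ((B ∩ T).card : ℚ) * f B := by
  simp_rw [Finset.sum_filter]
  rw [Finset.sum_comm]
  refine Finset.sum_congr rfl fun B _ => ?_
  rw [← Finset.sum_filter, Finset.sum_const, nsmul_eq_mul, Finset.filter_mem_eq_inter,
    Finset.inter_comm]

theorem sum_replication (L : Finset (Finset X)) (T : Finset X) :
    ∑ x ∈ T, (replication L x : ℚ) = ∑ B ∈ L, ((B ∩ T).card : ℚ) := by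
  simpa [replication] using sum_sum_filter_mem L T fun _ => 1

namespace IsRyserDesign

variable [Fintype X] {L : Finset (Finset X)} {v l : ℕ}

theorem card_sub_pos (hL : IsRyserDesign L v l) {B : Finset X} (hB : B ∈ L) :
    (0 : ℚ) < (B.card : ℚ) - l := by
  have := hL.index_lt B hB
  have : (l : ℚ) < B.card := by exact_mod_cast this
  linarith

theorem totalWeight_nonneg (hL : IsRyserDesign L v l) : 0 ≤ totalWeight L l :=
  Finset.sum_nonneg fun _ hB => (one_div_pos.2 (hL.card_sub_pos hB)).le

theorem sum_pointWeight (hL : IsRyserDesign L v l) {C : Finset X} (hC : C ∈ L) :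
    ∑ x ∈ C, pointWeight L l x = 1 + l * totalWeight L l := by
  unfold pointWeight totalWeight
  rw [sum_sum_filter_mem, ← Finset.add_sum_erase _ _ hC, ← Finset.add_sum_erase L _ hC,
    Finset.inter_self, mul_add, Finset.mul_sum]
  have h : ∑ B ∈ L.erase C, ((B ∩ C).card : ℚ) * (1 / ((B.card : ℚ) - l)) =
      ∑ B ∈ L.erase C, (l : ℚ) * (1 / ((B.card : ℚ) - l)) := by
    refine Finset.sum_congr rfl fun B hB => ?_
    rw [hL.card_inter B (Finset.mem_of_mem_erase hB) C hC (Finset.ne_of_mem_erase hB)]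
  rw [h]
  have := (hL.card_sub_pos hC).ne'
  field_simp
  ring

/-- A left inverse of the square incidence matrix is also a right inverse; this is the `(x, y)`
entry of that second product. -/
theorem sum_pair (hL : IsRyserDesign L v l) (x y : X) :
    ∑ B ∈ L with x ∈ B ∧ y ∈ B, 1 / ((B.card : ℚ) - l) =
      (if x = y then 1 else 0) +
        l / (1 + l * totalWeight L l) * (pointWeight L l x * pointWeight L l y) := by
  set c : ℚ := l / (1 + l * totalWeight L l) with hc
  have hpos : (0 : ℚ) < 1 + l * totalWeight L l := by
    have := mul_nonneg (Nat.cast_nonneg (α := ℚ) l) hL.totalWeight_nonneg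
    linarith
  let N : Matrix X L ℚ := Matrix.of fun x B => if x ∈ B.1 then 1 else 0
  -- The Sherman–Morrison inverse of diagonal plus `l` times all-ones, multiplied by the transpose
  -- of `N`.
  let P : Matrix L X ℚ := Matrix.of fun B y =>
    1 / ((B.1.card : ℚ) - l) * ((if y ∈ B.1 then 1 else 0) - c * pointWeight L l y)
  have hPN : P * N = 1 := by
    ext B C
    have h1 : (P * N) B C =
        1 / ((B.1.card : ℚ) - l) * (((B.1 ∩ C.1).card : ℚ) -
          c * ∑ y ∈ C.1, pointWeight L l y) := by
      simp only [Matrix.mul_apply, P, N, Matrix.of_apply, mul_ite, mul_one, mul_zero]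
      rw [← Finset.sum_filter, Finset.filter_mem_eq_inter, Finset.univ_inter, ← Finset.mul_sum,
        Finset.sum_sub_distrib, Finset.mul_sum, ← Finset.sum_filter, Finset.sum_const,
        nsmul_eq_mul, mul_one, Finset.filter_mem_eq_inter, Finset.inter_comm]
    rw [h1, hL.sum_pointWeight C.2, hc, div_mul_cancel₀ _ hpos.ne']
    by_cases h : B = C
    · subst h
      rw [Finset.inter_self, Matrix.one_apply_eq, one_div_mul_cancel (hL.card_sub_pos B.2).ne']
    · rw [Matrix.one_apply_ne h, hL.card_inter B.1 B.2 C.1 C.2 fun h' => h (Subtype.ext h')]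
      simp
  have hcard : Fintype.card L = Fintype.card X := by
    rw [Fintype.card_coe, hL.card_blocks, hL.card_points]
  have hNP : N * P = 1 := (Matrix.mul_eq_one_comm_of_card_eq _ _ _ hcard).1 hPN
  have h := congrFun (congrFun hNP x) y
  rw [Matrix.one_apply] at h
  rw [← h]
  have h2 : (N * P) x y = ∑ B ∈ L, if x ∈ B then
      1 / ((B.card : ℚ) - l) * ((if y ∈ B then 1 else 0) - c * pointWeight L l y) else 0 := by
    rw [← Finset.sum_coe_sort L]
    simp only [Matrix.mul_apply, P, N, Matrix.of_apply, ite_mul, one_mul, zero_mul]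
  rw [h2, ← Finset.sum_filter]
  simp only [mul_sub, Finset.sum_sub_distrib, ← Finset.sum_mul]
  simp only [mul_ite, mul_one, mul_zero]
  rw [← Finset.sum_filter, Finset.filter_filter]
  change _ = _ - pointWeight L l x * _ + _
  ring

theorem mul_pointWeight_sq (hL : IsRyserDesign L v l) (x : X) :
    l / (1 + l * totalWeight L l) * (pointWeight L l x * pointWeight L l x) =
      pointWeight L l x - 1 := by
  have h := hL.sum_pair x x
  simp only [and_self, if_true] at h
  change pointWeight L l x = _ at h
  linarith

/-- Sum `sum_pair` over `y`, using `|B| / (|B| - l) = 1 + l / (|B| - l)`. -/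
theorem replication_sub_one (hL : IsRyserDesign L v l) (x : X) :
    (replication L x : ℚ) - 1 =
      l / (1 + l * totalWeight L l) * ((v : ℚ) - 1) * pointWeight L l x := by
  have hpos : (0 : ℚ) < 1 + l * totalWeight L l := by
    have := mul_nonneg (Nat.cast_nonneg (α := ℚ) l) hL.totalWeight_nonneg
    linarith
  have key : ∀ M ⊆ L, ∑ B ∈ M, (B.card : ℚ) * (1 / ((B.card : ℚ) - l)) =
      M.card + l * ∑ B ∈ M, 1 / ((B.card : ℚ) - l) := by
    intro M hM
    rw [Finset.mul_sum, Finset.card_eq_sum_ones, Nat.cast_sum, ← Finset.sum_add_distrib]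
    refine Finset.sum_congr rfl fun B hB => ?_
    have := (hL.card_sub_pos (hM hB)).ne'
    field_simp
    push_cast
    ring
  have hW : ∑ y, pointWeight L l y = v + l * totalWeight L l := by
    unfold pointWeight
    rw [sum_sum_filter_mem]
    simp only [Finset.inter_univ]
    rw [key L subset_rfl, hL.card_blocks]
    rfl
  have hs : ∑ y, ∑ B ∈ L with x ∈ B ∧ y ∈ B, 1 / ((B.card : ℚ) - l) =
      replication L x + l * pointWeight L l x := by
    simp_rw [← Finset.filter_filter]
    rw [sum_sum_filter_mem]
    simp only [Finset.inter_univ]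
    rw [key _ (Finset.filter_subset _ _)]
    rfl
  rw [Finset.sum_congr rfl fun y _ => hL.sum_pair x y, Finset.sum_add_distrib, ← Finset.mul_sum,
    ← Finset.mul_sum, hW, Finset.sum_ite_eq, if_pos (Finset.mem_univ _)] at hs
  have : (replication L x : ℚ) - 1 = l / (1 + l * totalWeight L l) *
      (pointWeight L l x * (v + l * totalWeight L l)) - l * pointWeight L l x := by linarith
  rw [this]
  field_simp
  ring

end IsRyserDesign

end RyserWoodall

/-! ### The Ryser–Woodall theorem for integral ratio. -/

section RyserWoodallTheorem

variable {X : Type*} [Fintype X] [DecidableEq X]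

/-- The conclusions of the Ryser-Woodall theorem for a Ryser design with `ρ = n` an integer: `E` is
the set of points of the larger replication number `1 + n * g`, and all other points have
replication number `1 + g`. -/
structure HasIntegralRatio (L : Finset (Finset X)) (v l n g : ℕ) (E : Finset X) : Prop where
  one_lt_ratio : 1 < n
  pos : 0 < g
  order_eq : v = 1 + (n + 1) * g
  replication_of_mem : ∀ x ∈ E, replication L x = 1 + n * g
  replication_of_notMem : ∀ x ∉ E, replication L x = 1 + g
  nonempty : E.Nonempty
  compl_nonempty : Eᶜ.Nonempty
  card_inter_add : ∀ B ∈ L, n * (B ∩ E).card + (B \ E).card = l * (n + 1)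
  totalWeight_eq : 1 / (l : ℚ) + totalWeight L l = ((n : ℚ) + 1) ^ 2 / n
  pointWeight_eq : ∀ x ∉ E, pointWeight L l x = ((n : ℚ) + 1) / n
  sum_pair_eq : ∀ x ∉ E, ∀ y ∉ E, x ≠ y →
    ∑ B ∈ L with x ∈ B ∧ y ∈ B, 1 / ((B.card : ℚ) - l) = 1 / n

theorem IsRyserDesign.exists_hasIntegralRatio {L : Finset (Finset X)} {v l n : ℕ}
    (hL : IsRyserDesign L v l) (hl : 0 < l) (hn : rho L = n) :
    ∃ g E, HasIntegralRatio L v l n g E := by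
  have hl' : (0 : ℚ) < l := by exact_mod_cast hl
  have hpos : (0 : ℚ) < 1 + l * totalWeight L l := by
    have := mul_nonneg hl'.le hL.totalWeight_nonneg
    linarith
  have hrep := hL.replication_sub_one
  have hsq := hL.mul_pointWeight_sq
  have hpair := hL.sum_pair
  set c : ℚ := l / (1 + l * totalWeight L l) with hc
  have hc0 : 0 < c := div_pos hl' hpos
  set w := pointWeight L l with hw
  have hw1 (x) : 1 ≤ w x := by
    have := mul_nonneg hc0.le (mul_self_nonneg (w x))
    linarith [hsq x]
  obtain ⟨B₁, hB₁, B₂, hB₂, hne⟩ := hL.exists_card_ne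
  have hv : 1 < v := by
    rw [← hL.card_blocks, Finset.one_lt_card]
    exact ⟨B₁, hB₁, B₂, hB₂, fun h => hne (by rw [h])⟩
  have hv' : (0 : ℚ) < (v : ℚ) - 1 := by
    have : (1 : ℚ) < v := by exact_mod_cast hv
    linarith
  have hk : 0 < c * ((v : ℚ) - 1) := mul_pos hc0 hv'
  have : Nonempty X := Fintype.card_pos_iff.1 (by rw [hL.card_points]; omega)
  obtain ⟨x₀, hx₀⟩ := exists_eq_ciSup_of_finite (f := replication L)
  obtain ⟨y₀, hy₀⟩ := exists_eq_ciInf_of_finite (f := replication L)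
  have hmax (x) : replication L x ≤ replication L x₀ := by
    rw [hx₀]; exact le_ciSup (Set.finite_range _).bddAbove x
  have hmin (x) : replication L y₀ ≤ replication L x := by
    rw [hy₀]; exact ciInf_le (Set.finite_range _).bddBelow x
  have hmono {x y} (h : replication L x ≤ replication L y) : w x ≤ w y := by
    have h' : (replication L x : ℚ) ≤ replication L y := by exact_mod_cast h
    have : c * ((v : ℚ) - 1) * w x ≤ c * ((v : ℚ) - 1) * w y := by
      rw [← hrep, ← hrep]; linarith
    exact le_of_mul_le_mul_left this hk
  -- Constant weight would make all blocks the same size, since the total weight on a block does not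
  -- depend on the block.
  have hlt : w y₀ < w x₀ := by
    by_contra hcon
    have hconst (x) : w x = w y₀ :=
      le_antisymm ((hmono (hmax x)).trans (not_lt.1 hcon)) (hmono (hmin x))
    have h1 := hL.sum_pointWeight hB₁
    have h2 := hL.sum_pointWeight hB₂
    rw [Finset.sum_congr rfl fun x _ => hconst x, Finset.sum_const, nsmul_eq_mul] at h1 h2
    have h3 := mul_right_cancel₀ (by linarith [hw1 y₀] : w y₀ ≠ 0) (h1.trans h2.symm)
    exact hne (by exact_mod_cast h3)
  -- Vieta's relations for `c w² - w + 1 = 0`, whose roots are the two extreme weights.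
  have hsum : c * (w x₀ + w y₀) = 1 := by
    refine mul_right_cancel₀ (sub_pos.2 hlt).ne' ?_
    linear_combination hsq x₀ - hsq y₀
  have hprod : c * (w x₀ * w y₀) = 1 := by
    linear_combination w x₀ * hsum - hsq x₀
  have htwo (x) : w x = w x₀ ∨ w x = w y₀ := by
    have : c * ((w x - w x₀) * (w x - w y₀)) = 0 := by
      linear_combination hsq x - w x * hsum + hprod
    rcases mul_eq_zero.1 ((mul_eq_zero.1 this).resolve_left hc0.ne') with h | h
    · exact .inl (sub_eq_zero.1 h)
    · exact .inr (sub_eq_zero.1 h)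
  have hy0 : 0 < w y₀ := by linarith [hw1 y₀]
  have hnw : w x₀ = n * w y₀ := by
    have h : rho L = ((replication L x₀ : ℚ) - 1) / ((replication L y₀ : ℚ) - 1) := by
      rw [hx₀, hy₀]; rfl
    rw [hrep, hrep, mul_div_mul_left _ _ hk.ne', hn] at h
    rw [h, div_mul_cancel₀ _ hy0.ne']
  have hn1 : (1 : ℚ) < n := by
    refine lt_of_mul_lt_mul_right ?_ hy0.le
    rwa [one_mul, ← hnw]
  have hn0 : (n : ℚ) ≠ 0 := by linarith
  have hwy : w y₀ = ((n : ℚ) + 1) / n := by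
    rw [eq_div_iff hn0]
    refine mul_left_cancel₀ (mul_pos hc0 hy0).ne' ?_
    linear_combination hprod - hsum + (c - c * w y₀) * hnw
  have hwx : w x₀ = (n : ℚ) + 1 := by rw [hnw, hwy, mul_div_cancel₀ _ hn0]
  have hcn : c * ((n : ℚ) + 1) ^ 2 = n := by
    rw [hwx, hwy] at hprod
    field_simp at hprod
    linear_combination hprod
  have hn2 : 1 < n := by exact_mod_cast hn1
  have hκ : c * ((v : ℚ) - 1) * (n + 1) ^ 2 = n * (v - 1) := by
    linear_combination ((v : ℚ) - 1) * hcn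
  obtain ⟨g, hg⟩ : ∃ g : ℕ, replication L y₀ = 1 + g := by
    refine Nat.exists_eq_add_of_le ?_
    have : (1 : ℚ) < replication L y₀ := by
      have := mul_pos hk hy0
      rw [← hrep] at this
      linarith
    exact (by exact_mod_cast this : 1 < replication L y₀).le
  have hgw : (g : ℚ) = c * ((v : ℚ) - 1) * w y₀ := by
    rw [← hrep, hg]; push_cast; ring
  have hgx : replication L x₀ = 1 + n * g := by
    have h := hrep x₀
    rw [hnw] at h
    have : (replication L x₀ : ℚ) = 1 + n * g := by rw [hgw]; linear_combination h
    exact_mod_cast this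
  have hrepw {x y} (h : w x = w y) : replication L x = replication L y := by
    have : (replication L x : ℚ) = replication L y := by
      linear_combination hrep x - hrep y + c * ((v : ℚ) - 1) * h
    exact_mod_cast this
  have hout {x} (h : ¬ w x = w x₀) : w x = w y₀ := (htwo x).resolve_left h
  have hcl : (1 + l * totalWeight L l) * n = l * (n + 1) ^ 2 := by
    have : c * (1 + l * totalWeight L l) = l := div_mul_cancel₀ _ hpos.ne'
    linear_combination -(1 + l * totalWeight L l) * hcn + ((n : ℚ) + 1) ^ 2 * this
  obtain ⟨E, hmem⟩ : ∃ E : Finset X, ∀ {x}, x ∈ E ↔ w x = w x₀ :=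
    ⟨Finset.univ.filter (fun x => w x = w x₀), by simp⟩
  refine ⟨g, E, hn2, ?_, ?_, ?_, ?_, ⟨x₀, hmem.2 rfl⟩,
    ⟨y₀, by rw [Finset.mem_compl, hmem]; exact hlt.ne⟩, ?_, ?_, ?_, ?_⟩
  · have : (0 : ℚ) < g := by rw [hgw]; positivity
    exact_mod_cast this
  · have : (v : ℚ) = 1 + (n + 1) * g := by
      rw [hgw, hwy]
      field_simp
      linear_combination -hκ
    exact_mod_cast this
  · intro x hx
    rw [hrepw (hmem.1 hx), hgx]
  · intro x hx
    rw [hrepw (hout fun h => hx (hmem.2 h)), hg]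
  · intro B hB
    have h := hL.sum_pointWeight hB
    rw [← Finset.sum_inter_add_sum_sdiff B E,
      Finset.sum_congr rfl fun x hx => hmem.1 (Finset.mem_inter.1 hx).2,
      Finset.sum_congr (s₁ := B \ _) rfl fun x hx =>
        hout fun h => (Finset.mem_sdiff.1 hx).2 (hmem.2 h),
      Finset.sum_const, Finset.sum_const, nsmul_eq_mul, nsmul_eq_mul, hwx, hwy] at h
    have : (n : ℚ) * (B ∩ E).card + (B \ E).card = l * (n + 1) := by
      rw [← h] at hcl
      field_simp at hcl
      linear_combination hcl
    exact_mod_cast this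
  · field_simp
    linear_combination hcl
  · intro x hx
    rw [← hwy]
    exact hout fun h => hx (hmem.2 h)
  · intro x hx y hy hxy
    rw [hpair, if_neg hxy, hout fun h => hx (hmem.2 h), hout fun h => hy (hmem.2 h), hsq, hwy]
    field_simp
    ring

end RyserWoodallTheorem

/-! ### Complementation with respect to a block, and a criterion for Type-1. -/

section Complementation

variable {X : Type*} [DecidableEq X]

theorem card_symmDiff_add (A B : Finset X) :
    (symmDiff A B).card + 2 * (A ∩ B).card = A.card + B.card := by
  have h : (symmDiff A B).card = (A \ B).card + (B \ A).card :=
    Finset.card_union_of_disjoint disjoint_sdiff_sdiff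
  have h1 := Finset.card_inter_add_card_sdiff A B
  have h2 := Finset.card_inter_add_card_sdiff B A
  rw [Finset.inter_comm B A] at h2
  omega

theorem card_inter_symmDiff (A B : Finset X) :
    (A ∩ symmDiff A B).card + (A ∩ B).card = A.card := by
  have h : A ∩ symmDiff A B = A \ B := by
    ext x
    simp only [Finset.mem_inter, Finset.mem_symmDiff, Finset.mem_sdiff]
    tauto
  rw [h, add_comm, Finset.card_inter_add_card_sdiff]

theorem card_symmDiff_inter_symmDiff (A B C : Finset X) :
    (symmDiff A B ∩ symmDiff A C).card + (A ∩ B).card + (A ∩ C).card =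
      A.card + (B ∩ C).card := by
  have h1 : symmDiff A B ∩ symmDiff A C = (A \ (B ∪ C)) ∪ ((B ∩ C) \ A) := by
    ext x
    simp only [Finset.mem_inter, Finset.mem_symmDiff, Finset.mem_sdiff, Finset.mem_union]
    tauto
  have h2 : Disjoint (A \ (B ∪ C)) ((B ∩ C) \ A) := by
    rw [Finset.disjoint_left]
    intro x hx hx'
    exact (Finset.mem_sdiff.1 hx').2 (Finset.mem_sdiff.1 hx).1
  have h3 := Finset.card_inter_add_card_sdiff A (B ∪ C)
  have h4 := Finset.card_inter_add_card_sdiff (B ∩ C) A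
  have h5 := Finset.card_union_add_card_inter (A ∩ B) (A ∩ C)
  rw [← Finset.inter_union_distrib_left] at h5
  have h6 : A ∩ B ∩ (A ∩ C) = B ∩ C ∩ A := by
    ext x
    simp only [Finset.mem_inter]
    tauto
  rw [h6] at h5
  rw [h1, Finset.card_union_of_disjoint h2]
  omega

theorem mem_blockComplement {L : Finset (Finset X)} {A D : Finset X} :
    D ∈ blockComplement L A ↔ D = A ∨ ∃ B ∈ L, B ≠ A ∧ symmDiff A B = D := by
  simp only [blockComplement, Finset.mem_insert, Finset.mem_image, Finset.mem_erase]
  tauto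

/-- An empty block would be sent to `A` itself and lost, hence the assumption on `∅`. -/
theorem blockComplement_blockComplement {L : Finset (Finset X)} {A : Finset X} (hA : A ∈ L)
    (h : ∅ ∉ L) : blockComplement (blockComplement L A) A = L := by
  ext D
  simp only [mem_blockComplement]
  constructor
  · rintro (rfl | ⟨B, rfl | ⟨C, hC, -, rfl⟩, hB, rfl⟩)
    · exact hA
    · exact absurd rfl hB
    · rwa [symmDiff_symmDiff_cancel_left]
  · intro hD
    by_cases hDA : D = A
    · exact .inl hDA
    · refine .inr ⟨symmDiff A D, .inr ⟨D, hD, hDA, rfl⟩, ?_, symmDiff_symmDiff_cancel_left _ _⟩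
      intro h'
      rw [symmDiff_eq_left] at h'
      exact h (by simpa [h'] using hD)

theorem card_blockComplement {L : Finset (Finset X)} {A : Finset X} (hA : A ∈ L)
    (h : ∅ ∉ L) : (blockComplement L A).card = L.card := by
  unfold blockComplement
  rw [Finset.card_insert_of_notMem, Finset.card_image_of_injective _ (symmDiff_right_injective A),
    Finset.card_erase_add_one hA]
  intro h'
  obtain ⟨B, hB, hBA⟩ := Finset.mem_image.1 h'
  rw [symmDiff_eq_left] at hBA
  exact h (by simpa [hBA] using Finset.mem_of_mem_erase hB)

/-- Complementing with respect to `A` gives blocks of size `|A| + 2l - 2l = |A|` meeting in `|A| -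
l` points, and complementing again restores `L`. -/
theorem IsRyserDesign.isType1_of_card_eq [Fintype X] {L : Finset (Finset X)} {v l : ℕ}
    (hL : IsRyserDesign L v l) (hl : 0 < l) {A : Finset X} (hA : A ∈ L)
    (h : ∀ B ∈ L, B ≠ A → B.card = 2 * l) : IsType1 L := by
  have hne : ∅ ∉ L := fun h' => by simpa using hL.index_lt _ h'
  have hAl := hL.index_lt A hA
  refine ⟨blockComplement L A, v, A.card, A.card - l, A, ?_, mem_blockComplement.2 (.inl rfl),
    (blockComplement_blockComplement hA hne).symm⟩
  have hint {B} (hB : B ∈ L) (hBA : B ≠ A) : (A ∩ B).card = l := hL.card_inter A hA B hB hBA.symm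
  refine ⟨hL.card_points, by rw [card_blockComplement hA hne, hL.card_blocks], by omega, ?_, ?_,
    by omega⟩
  · intro D₁ h₁ D₂ h₂ h₁₂
    rw [mem_blockComplement] at h₁ h₂
    rcases h₁ with rfl | ⟨B, hB, hBA, rfl⟩ <;> rcases h₂ with rfl | ⟨C, hC, hCA, rfl⟩
    · exact absurd rfl h₁₂
    · have := card_inter_symmDiff D₁ C
      rw [hint hC hCA] at this
      omega
    · have := card_inter_symmDiff D₂ B
      rw [hint hB hBA] at this
      rw [Finset.inter_comm]
      omega
    · have := card_symmDiff_inter_symmDiff A B C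
      rw [hint hB hBA, hint hC hCA,
        hL.card_inter B hB C hC fun h => h₁₂ (by rw [h])] at this
      omega
  · intro D hD
    rcases mem_blockComplement.1 hD with rfl | ⟨B, hB, hBA, rfl⟩
    · rfl
    · have := card_symmDiff_add A B
      rw [hint hB hBA, h B hB hBA] at this
      omega

end Complementation

/-! ### Deficits of blocks, and the case `ρ = λ`. -/

section Deficit

variable {X : Type*} [DecidableEq X]

/-- The amount by which the number of points of `E` on the block `B` falls short of `l`. -/
def deficit (E : Finset X) (l : ℕ) (B : Finset X) : ℤ := l - (B ∩ E).card

theorem exists_forall_ne_eq_zero_of_sum {α : Type*} [DecidableEq α] (L : Finset α) (s : α → ℤ)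
    {c : ℤ} (hc : c ≠ 0) (h : ∀ B ∈ L, s B = 0 ∨ s B = c) (hsum : ∑ B ∈ L, s B = c) :
    ∃ A ∈ L, ∀ B ∈ L, B ≠ A → s B = 0 := by
  obtain ⟨A, hA, hA0⟩ : ∃ A ∈ L, s A ≠ 0 := by
    by_contra! hcon
    exact hc (by rw [← hsum, Finset.sum_eq_zero hcon])
  have hAc := (h A hA).resolve_left hA0
  rw [← Finset.add_sum_erase _ _ hA, hAc, add_eq_left] at hsum
  -- The factor `c` makes all terms nonnegative whatever the sign of `c`.
  have h0 : ∑ B ∈ L.erase A, c * s B = 0 := by rw [← Finset.mul_sum, hsum, mul_zero]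
  refine ⟨A, hA, fun B hB hBA => ?_⟩
  have hnn : ∀ B ∈ L.erase A, 0 ≤ c * s B := fun B hB => by
    rcases h B (Finset.mem_of_mem_erase hB) with h | h <;> rw [h]
    · simp
    · exact mul_self_nonneg c
  have := (Finset.sum_eq_zero_iff_of_nonneg hnn).1 h0 B (Finset.mem_erase.2 ⟨hBA, hB⟩)
  exact (mul_eq_zero.1 this).resolve_left hc

variable [Fintype X] {L : Finset (Finset X)} {v l n g : ℕ} {E : Finset X}

namespace HasIntegralRatio

theorem card_sdiff_eq (H : HasIntegralRatio L v l n g E) {B : Finset X} (hB : B ∈ L) :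
    ((B \ E).card : ℤ) = l + n * deficit E l B := by
  have h : (n : ℤ) * (B ∩ E).card + (B \ E).card = l * (n + 1) := by
    exact_mod_cast H.card_inter_add B hB
  unfold deficit
  linear_combination h

theorem card_eq (H : HasIntegralRatio L v l n g E) {B : Finset X} (hB : B ∈ L) :
    (B.card : ℤ) = 2 * l + (n - 1) * deficit E l B := by
  have h1 : ((B ∩ E).card : ℤ) + (B \ E).card = B.card := by
    exact_mod_cast Finset.card_inter_add_card_sdiff B E
  have h2 := H.card_sdiff_eq hB
  unfold deficit at *
  linear_combination -h1 + h2

theorem cast_card_sub (H : HasIntegralRatio L v l n g E) {B : Finset X} (hB : B ∈ L) :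
    (B.card : ℚ) - l = l + (n - 1) * deficit E l B := by
  have h : (B.card : ℚ) = 2 * l + (n - 1) * deficit E l B := by exact_mod_cast H.card_eq hB
  rw [h]
  ring

theorem sum_deficit (H : HasIntegralRatio L v l n g E) (hL : IsRyserDesign L v l) :
    ∑ B ∈ L, deficit E l B = v * l - E.card * (1 + n * g) := by
  have h := sum_replication L E
  rw [Finset.sum_congr rfl fun x hx => by rw [H.replication_of_mem x hx], Finset.sum_const,
    nsmul_eq_mul] at h
  have h' : (E.card : ℤ) * (1 + n * g) = ∑ B ∈ L, ((B ∩ E).card : ℤ) := by exact_mod_cast h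
  unfold deficit
  rw [Finset.sum_sub_distrib, ← h', Finset.sum_const, hL.card_blocks, nsmul_eq_mul]

/-- Count incidences inside and outside `E`; the deficit sum links the two counts, and a factor `v`
cancels. -/
theorem card_mul (H : HasIntegralRatio L v l n g E) (hL : IsRyserDesign L v l) :
    (E.card : ℤ) * (n - 1) = l * (n + 1) - 1 - g := by
  have h1 := sum_replication L Eᶜ
  rw [Finset.sum_congr rfl fun x hx => by
    rw [H.replication_of_notMem x (Finset.mem_compl.1 hx)], Finset.sum_const,
    nsmul_eq_mul, Finset.card_compl, Nat.cast_sub (Finset.card_le_univ _), hL.card_points] at h1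
  have h2 := H.sum_deficit hL
  have h3 : ∑ B ∈ L, ((B \ E).card : ℤ) = v * l + n * ∑ B ∈ L, deficit E l B := by
    rw [Finset.sum_congr rfl fun B hB => H.card_sdiff_eq hB, Finset.sum_add_distrib,
      ← Finset.mul_sum, Finset.sum_const, hL.card_blocks, nsmul_eq_mul]
  simp_rw [← Finset.sdiff_eq_inter_compl] at h1
  have h1' : ((v : ℤ) - E.card) * (1 + g) = ∑ B ∈ L, ((B \ E).card : ℤ) := by exact_mod_cast h1
  have hv : (v : ℤ) = 1 + (n + 1) * g := by exact_mod_cast H.order_eq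
  have hv0 : (v : ℤ) ≠ 0 := by rw [hv]; positivity
  rw [h2, ← h1'] at h3
  refine mul_right_cancel₀ hv0 ?_
  linear_combination h3 + (E.card : ℤ) * (n - 1) * hv

theorem card_lt (H : HasIntegralRatio L v l n g E) (hL : IsRyserDesign L v l) : E.card < v := by
  have := H.compl_nonempty.card_pos
  rw [Finset.card_compl, hL.card_points] at this
  omega

theorem card_sdiff_le (_ : HasIntegralRatio L v l n g E) (hL : IsRyserDesign L v l)
    (B : Finset X) : ((B \ E).card : ℤ) ≤ v - E.card := by
  have h1 := Finset.card_le_univ (B \ E ∪ E)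
  rw [Finset.card_union_of_disjoint Finset.sdiff_disjoint, hL.card_points] at h1
  omega

theorem sum_one_div (H : HasIntegralRatio L v l n g E) :
    ∑ B ∈ L, 1 / ((l : ℚ) + (n - 1) * deficit E l B) = ((n : ℚ) + 1) ^ 2 / n - 1 / l := by
  rw [← H.totalWeight_eq, totalWeight,
    Finset.sum_congr rfl fun B hB => by rw [← H.cast_card_sub hB]]
  ring

theorem isType1_of_ratio_eq (H : HasIntegralRatio L v l n g E) (hL : IsRyserDesign L v l)
    (hv : v ≤ l ^ 2 + l + 1) (hn : n = l) : IsType1 L := by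
  subst hn
  have hl := H.one_lt_ratio
  have hg0 := H.pos
  have hvg : (v : ℤ) = 1 + (n + 1) * g := by exact_mod_cast H.order_eq
  have hgn : g ≤ n := by
    have := H.order_eq
    nlinarith
  have he := H.card_mul hL
  have hlt := H.card_lt hL
  have ht : ((n : ℤ) + 2 - E.card) * (n - 1) = g - 1 := by linear_combination -he
  obtain ⟨t, ht'⟩ : ∃ t : ℤ, t = (n : ℤ) + 2 - E.card := ⟨_, rfl⟩
  rw [← ht'] at ht
  zify at hl hg0 hgn hlt
  have ht0 : 0 ≤ t := by
    by_contra! h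
    nlinarith
  -- If `t = 0` then `g = 1` and `|E| = n + 2 = v`, leaving no point outside `E`.
  have ht1 : 1 ≤ t := by
    by_contra! h
    obtain rfl : t = 0 := by omega
    have : (g : ℤ) = 1 := by linarith
    rw [this] at hvg
    omega
  have hgn' : (g : ℤ) = n := by nlinarith
  have hE : (E.card : ℤ) = n + 1 := by nlinarith
  have hsum : ∑ B ∈ L, deficit E n B = -1 := by
    rw [H.sum_deficit hL, hvg, hE, hgn']
    ring
  have hl0 : (1 : ℚ) < n := by exact_mod_cast hl
  have hge : ∀ B ∈ L, -1 ≤ deficit E n B := fun B hB => by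
    have := H.card_sdiff_eq hB
    by_contra! h
    nlinarith
  have hpos : ∀ B ∈ L, 0 < (n : ℚ) + (n - 1) * deficit E n B := fun B hB => by
    rw [← H.cast_card_sub hB]
    exact hL.card_sub_pos hB
  have h0 : ∑ B ∈ L, ((deficit E n B : ℚ) * (deficit E n B + 1)) /
      (n + (n - 1) * deficit E n B) = 0 := by
    -- Up to the factor `n`, the right side is the gap between `1 / (n + (n - 1)s)` and its chord
    -- through `s = -1` and `s = 0`.
    have h1 : ∀ B ∈ L, ((deficit E n B : ℚ) * (deficit E n B + 1)) /
        (n + (n - 1) * deficit E n B) * (n - 1) ^ 2 =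
        n * (1 / ((n : ℚ) + (n - 1) * deficit E n B)) - 1 + (n - 1) * deficit E n B := by
      intro B hB
      have := (hpos B hB).ne'
      obtain ⟨d, hd⟩ : ∃ d : ℚ, d = n + (n - 1) * deficit E n B := ⟨_, rfl⟩
      rw [← hd] at this ⊢
      field_simp
      rw [hd]
      ring
    have h2 : (∑ B ∈ L, ((deficit E n B : ℚ) * (deficit E n B + 1)) /
      (n + (n - 1) * deficit E n B)) * (n - 1) ^ 2 = 0 := by
      have hsum' : ∑ B ∈ L, (deficit E n B : ℚ) = -1 := by exact_mod_cast hsum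
      have hvq : (v : ℚ) = 1 + (n + 1) * n := by
        have : (v : ℤ) = 1 + (n + 1) * n := by rw [hvg, hgn']
        exact_mod_cast this
      rw [Finset.sum_mul, Finset.sum_congr rfl h1, Finset.sum_add_distrib,
        Finset.sum_sub_distrib, ← Finset.mul_sum, ← Finset.mul_sum, hsum', H.sum_one_div,
        Finset.sum_const, hL.card_blocks, nsmul_eq_mul, hvq]
      field_simp
      ring
    have h3 : ((n : ℚ) - 1) ^ 2 ≠ 0 := pow_ne_zero _ (by linarith)
    exact (mul_eq_zero.1 h2).resolve_right h3
  have hnn : ∀ B ∈ L, 0 ≤ ((deficit E n B : ℚ) * (deficit E n B + 1)) /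
      (n + (n - 1) * deficit E n B) := fun B hB => by
    refine div_nonneg ?_ (hpos B hB).le
    have h1 := hge B hB
    have : 0 ≤ deficit E n B * (deficit E n B + 1) := by
      rcases h1.eq_or_lt with h | h
      · rw [← h]; norm_num
      · exact mul_nonneg (by omega) (by omega)
    exact_mod_cast this
  obtain ⟨A, hA, h⟩ := exists_forall_ne_eq_zero_of_sum L (deficit E n) (c := -1) (by norm_num)
    (fun B hB => by
      have := (Finset.sum_eq_zero_iff_of_nonneg hnn).1 h0 B hB
      have := (div_eq_zero_iff.1 this).resolve_right (hpos B hB).ne'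
      have : deficit E n B * (deficit E n B + 1) = 0 := by exact_mod_cast this
      rcases mul_eq_zero.1 this with h | h
      · exact .inl h
      · exact .inr (by omega)) hsum
  refine hL.isType1_of_card_eq (by omega) hA fun B hB hBA => ?_
  have := H.card_eq hB
  rw [h B hB hBA] at this
  omega

end HasIntegralRatio

end Deficit

/-! ### The case `ρ = λ - 1`. -/

section RatioAddOne

variable {X : Type*} [DecidableEq X] [Fintype X] {L : Finset (Finset X)} {v l n g : ℕ}
  {E : Finset X}

namespace HasIntegralRatio

/-- A block of deficit `-1` has only one point outside `E`. If `a` and `b` blocks through the pair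
have deficits `1` and `0`, then `a / (2n) + b / (n + 1) = 1 / n`, which forces `a = 2`, `b = 0`. -/
theorem deficit_eq_one_of_pair (H : HasIntegralRatio L v l n g E) (hn : l = n + 1)
    (hs : ∀ B ∈ L, deficit E l B = -1 ∨ deficit E l B = 0 ∨ deficit E l B = 1)
    {x y : X} (hx : x ∉ E) (hy : y ∉ E) (hxy : x ≠ y) :
    (∀ B ∈ L.filter (fun B => x ∈ B ∧ y ∈ B), deficit E l B = 1) ∧
      (L.filter (fun B => x ∈ B ∧ y ∈ B)).card = 2 := by
  have hn2 := H.one_lt_ratio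
  have hsum := H.sum_pair_eq x hx y hy hxy
  set T := L.filter (fun B => x ∈ B ∧ y ∈ B) with hT
  have hT01 : ∀ B ∈ T, deficit E l B = 0 ∨ deficit E l B = 1 := by
    intro B hB
    obtain ⟨hBL, hxB, hyB⟩ := Finset.mem_filter.1 hB
    refine (hs B hBL).resolve_left fun h => ?_
    have h1 := H.card_sdiff_eq hBL
    rw [h, hn] at h1
    have h2 : 1 < (B \ E).card := Finset.one_lt_card.2
      ⟨x, Finset.mem_sdiff.2 ⟨hxB, hx⟩, y, Finset.mem_sdiff.2 ⟨hyB, hy⟩, hxy⟩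
    push_cast at h1
    omega
  have hcount : ∑ B ∈ T, 1 / ((B.card : ℚ) - l) =
      (T.filter (fun B => deficit E l B = 1)).card * (1 / (2 * n)) +
        (T.filter (fun B => ¬ deficit E l B = 1)).card * (1 / (n + 1)) := by
    rw [← Finset.sum_filter_add_sum_filter_not T (fun B => deficit E l B = 1), ← nsmul_eq_mul,
      ← nsmul_eq_mul, ← Finset.sum_const, ← Finset.sum_const]
    congr 1
    · refine Finset.sum_congr rfl fun B hB => ?_
      obtain ⟨hBT, h1⟩ := Finset.mem_filter.1 hB
      rw [H.cast_card_sub (Finset.mem_filter.1 hBT).1, h1, hn]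
      push_cast
      ring
    · refine Finset.sum_congr rfl fun B hB => ?_
      obtain ⟨hBT, h1⟩ := Finset.mem_filter.1 hB
      rw [H.cast_card_sub (Finset.mem_filter.1 hBT).1, (hT01 B hBT).resolve_right h1, hn]
      push_cast
      ring
  rw [hcount] at hsum
  have hcard := Finset.card_filter_add_card_filter_not (s := T) (fun B => deficit E l B = 1)
  have hzero : (T.filter (fun B => ¬ deficit E l B = 1)).card = 0 → ∀ B ∈ T, deficit E l B = 1 :=
    fun h B hB => by
      by_contra h1
      have := Finset.card_eq_zero.1 h
      exact Finset.notMem_empty B (this ▸ Finset.mem_filter.2 ⟨hB, h1⟩)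
  generalize (T.filter (fun B => deficit E l B = 1)).card = a at *
  generalize (T.filter (fun B => ¬ deficit E l B = 1)).card = b at *
  have hab : a * (n + 1) + 2 * n * b = 2 * (n + 1) := by
    have h0 : (n : ℚ) ≠ 0 := by
      have : n ≠ 0 := by omega
      exact_mod_cast this
    have h1 : (n : ℚ) + 1 ≠ 0 := by positivity
    field_simp at hsum
    have : (a : ℚ) * (n + 1) + 2 * n * b = 2 * (n + 1) := by linear_combination hsum
    exact_mod_cast this
  have hb : b = 0 := by
    rcases Nat.lt_or_ge b 2 with hb | hb
    · interval_cases b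
      · rfl
      · have ha : a * (n + 1) = 2 := by omega
        rcases Nat.eq_zero_or_pos a with rfl | ha'
        · omega
        · nlinarith
    · nlinarith
  subst hb
  have ha : a = 2 := Nat.eq_of_mul_eq_mul_right (Nat.succ_pos n) (by linarith)
  exact ⟨hzero rfl, by omega⟩

theorem deficit_ne_zero (H : HasIntegralRatio L v l n g E) (hn : l = n + 1)
    (hs : ∀ B ∈ L, deficit E l B = -1 ∨ deficit E l B = 0 ∨ deficit E l B = 1) :
    ∀ B ∈ L, deficit E l B ≠ 0 := by
  intro B hB h
  have h1 := H.card_sdiff_eq hB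
  have hn2 := H.one_lt_ratio
  rw [h] at h1
  obtain ⟨x, hx, y, hy, hxy⟩ := Finset.one_lt_card.1 (by omega : 1 < (B \ E).card)
  obtain ⟨hxB, hxE⟩ := Finset.mem_sdiff.1 hx
  obtain ⟨hyB, hyE⟩ := Finset.mem_sdiff.1 hy
  have := (H.deficit_eq_one_of_pair hn hs hxE hyE hxy).1 B (Finset.mem_filter.2 ⟨hB, hxB, hyB⟩)
  omega

theorem neg_one_le_deficit (H : HasIntegralRatio L v l n g E) (hn : l = n + 1) :
    ∀ B ∈ L, -1 ≤ deficit E l B := by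
  intro B hB
  have h1 := H.card_sdiff_eq hB
  have hn2 := H.one_lt_ratio
  by_contra! h
  zify at hn2 hn
  nlinarith

/-- A block of deficit `1` contains all of `Eᶜ`, so there are exactly two of them and all others
have deficit `-1`; the deficit sum is then off by one. -/
theorem false_of_eq_three (H : HasIntegralRatio L v l n g E) (hL : IsRyserDesign L v l)
    (hn : l = n + 1) (hg : g = 3) (hE : E.card = l + 2) : False := by
  have hn2 := H.one_lt_ratio
  have hv : v = 3 * l + 1 := by rw [H.order_eq, hg, hn]; ring
  have hs : ∀ B ∈ L, deficit E l B = -1 ∨ deficit E l B = 0 ∨ deficit E l B = 1 := by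
    intro B hB
    have h1 := H.neg_one_le_deficit hn B hB
    have h2 := H.card_sdiff_le hL B
    rw [H.card_sdiff_eq hB, hv, hE] at h2
    have h3 : deficit E l B ≤ 1 := by
      by_contra! h
      push_cast at h2
      zify at hn hn2
      nlinarith
    omega
  have hcard : Eᶜ.card = 2 * l - 1 := by
    rw [Finset.card_compl, hL.card_points, hv, hE]
    omega
  obtain ⟨x, hx, y, hy, hxy⟩ := Finset.one_lt_card.1 (by omega : 1 < Eᶜ.card)
  rw [Finset.mem_compl] at hx hy
  obtain ⟨h1, h2⟩ := H.deficit_eq_one_of_pair hn hs hx hy hxy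
  have h3 : ∀ B ∈ L.filter (fun B => ¬ (x ∈ B ∧ y ∈ B)), deficit E l B = -1 := by
    intro B hB
    obtain ⟨hBL, hxy'⟩ := Finset.mem_filter.1 hB
    rcases hs B hBL with h | h | h
    · exact h
    · exact absurd h (H.deficit_ne_zero hn hs B hBL)
    · have h4 := H.card_sdiff_eq hBL
      rw [h] at h4
      have h5 : B \ E = Eᶜ := Finset.eq_of_subset_of_card_le
        (fun z hz => Finset.mem_compl.2 (Finset.mem_sdiff.1 hz).2) (by omega)
      have h6 {z} (hz : z ∉ E) : z ∈ B :=
        (Finset.mem_sdiff.1 (h5 ▸ Finset.mem_compl.2 hz)).1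
      exact absurd ⟨h6 hx, h6 hy⟩ hxy'
  have hsum := H.sum_deficit hL
  have hc := Finset.card_filter_add_card_filter_not (s := L) (fun B => x ∈ B ∧ y ∈ B)
  rw [← Finset.sum_filter_add_sum_filter_not L (fun B => x ∈ B ∧ y ∈ B),
    Finset.sum_congr rfl h1, Finset.sum_congr rfl h3, Finset.sum_const, Finset.sum_const, h2,
    nsmul_eq_mul, nsmul_eq_mul, hE, hg, hv] at hsum
  rw [h2, hL.card_blocks, hv] at hc
  zify at hc hn
  rw [eq_sub_of_add_eq' hc] at hsum
  push_cast at hsum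
  rw [hn] at hsum
  have : (0 : ℤ) = 1 := by linear_combination hsum
  omega

theorem isType1_of_card_eq_succ (H : HasIntegralRatio L v l n g E) (hL : IsRyserDesign L v l)
    (hn : l = n + 1) (hg : g = l + 1) (hE : E.card = l + 1) : IsType1 L := by
  have hn2 := H.one_lt_ratio
  have hv : v = l ^ 2 + l + 1 := by rw [H.order_eq, hg, hn]; ring
  have hnz : (n : ℤ) = l - 1 := by omega
  have hsum : ∑ B ∈ L, deficit E l B = l := by
    rw [H.sum_deficit hL, hv, hg, hE, hnz]
    push_cast
    ring
  have hge := H.neg_one_le_deficit hn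
  have hle : ∀ B, deficit E l B ≤ l := fun B => by
    unfold deficit
    omega
  -- A block `C` of deficit `-1` contains `E` and one further point, so every other block has
  -- deficit `0` or `1`. Deficit `0` is excluded by `deficit_ne_zero`, and the sum becomes far
  -- larger than `l`.
  have hnn : ∀ B ∈ L, 0 ≤ deficit E l B := by
    by_contra! ⟨C, hC, hC0⟩
    have hC1 : deficit E l C = -1 := by
      have := hge C hC
      omega
    have h1 := H.card_sdiff_eq hC
    have hEC : C ∩ E = E := Finset.eq_of_subset_of_card_le Finset.inter_subset_right (by
      unfold deficit at hC1
      omega)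
    rw [hC1] at h1
    have h01 : ∀ B ∈ L, B ≠ C → deficit E l B = 0 ∨ deficit E l B = 1 := by
      intro B hB hBC
      have h2 := hL.card_inter B hB C hC hBC
      have h3 := Finset.card_inter_add_card_sdiff (B ∩ C) E
      have h4 : B ∩ C ∩ E = B ∩ E := by rw [Finset.inter_assoc, hEC]
      have h5 : ((B ∩ C) \ E).card ≤ (C \ E).card :=
        Finset.card_le_card (Finset.sdiff_subset_sdiff Finset.inter_subset_right subset_rfl)
      rw [h4, h2] at h3
      unfold deficit
      omega
    have hs : ∀ B ∈ L, deficit E l B = -1 ∨ deficit E l B = 0 ∨ deficit E l B = 1 := by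
      intro B hB
      by_cases hBC : B = C
      · exact .inl (hBC ▸ hC1)
      · exact .inr (h01 B hB hBC)
    have hone : ∀ B ∈ L.erase C, deficit E l B = 1 := fun B hB =>
      (h01 B (Finset.mem_of_mem_erase hB) (Finset.ne_of_mem_erase hB)).resolve_left
        (H.deficit_ne_zero hn hs B (Finset.mem_of_mem_erase hB))
    rw [← Finset.add_sum_erase _ _ hC, hC1, Finset.sum_congr rfl hone, Finset.sum_const,
      Finset.card_erase_of_mem hC, hL.card_blocks, hv, nsmul_eq_mul] at hsum
    push_cast at hsum
    nlinarith
  have hl3 : 3 ≤ l := by omega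
  have hl0 : (3 : ℚ) ≤ l := by exact_mod_cast hl3
  have hnq : (n : ℚ) = l - 1 := by rw [hn]; push_cast; ring
  have hpos : ∀ B ∈ L, 0 < (l : ℚ) + (n - 1) * deficit E l B := fun B hB => by
    rw [← H.cast_card_sub hB]
    exact hL.card_sub_pos hB
  have h0 : ∑ B ∈ L, ((deficit E l B : ℚ) * (l - deficit E l B)) /
      (l + (n - 1) * deficit E l B) = 0 := by
    -- The right side is the chord of `1 / (l + (l - 2)s)` through `s = 0` and `s = l`, minus the
    -- function.
    have h1 : ∀ B ∈ L, ((deficit E l B : ℚ) * (l - deficit E l B)) /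
        (l + (n - 1) * deficit E l B) * ((l - 2) ^ 2 / (l ^ 2 * (l - 1))) =
        1 / (l : ℚ) - (l - 2) / (l ^ 2 * (l - 1)) * deficit E l B -
          1 / ((l : ℚ) + (n - 1) * deficit E l B) := by
      intro B hB
      have := (hpos B hB).ne'
      obtain ⟨d, hd⟩ : ∃ d : ℚ, d = l + (n - 1) * deficit E l B := ⟨_, rfl⟩
      rw [← hd] at this ⊢
      have hl1 : (l : ℚ) - 1 ≠ 0 := by linarith
      field_simp
      rw [hd, hnq]
      ring
    have h2 : (∑ B ∈ L, ((deficit E l B : ℚ) * (l - deficit E l B)) /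
        (l + (n - 1) * deficit E l B)) * ((l - 2) ^ 2 / (l ^ 2 * (l - 1))) = 0 := by
      have hsum' : ∑ B ∈ L, (deficit E l B : ℚ) = l := by exact_mod_cast hsum
      rw [Finset.sum_mul, Finset.sum_congr rfl h1, Finset.sum_sub_distrib,
        Finset.sum_sub_distrib, ← Finset.mul_sum, hsum', H.sum_one_div,
        Finset.sum_const, hL.card_blocks, nsmul_eq_mul, hv, hnq]
      push_cast
      have hl1 : (l : ℚ) - 1 ≠ 0 := by linarith
      field_simp
      ring
    refine (mul_eq_zero.1 h2).resolve_right (ne_of_gt ?_)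
    have h3 : 0 < (l : ℚ) - 2 := by linarith
    have h4 : 0 < (l : ℚ) - 1 := by linarith
    positivity
  have hnn' : ∀ B ∈ L, 0 ≤ ((deficit E l B : ℚ) * (l - deficit E l B)) /
      (l + (n - 1) * deficit E l B) := fun B hB => by
    refine div_nonneg ?_ (hpos B hB).le
    have := mul_nonneg (hnn B hB) (sub_nonneg.2 (hle B))
    exact_mod_cast this
  obtain ⟨A, hA, h⟩ := exists_forall_ne_eq_zero_of_sum L (deficit E l) (c := l) (by omega)
    (fun B hB => by
      have := (Finset.sum_eq_zero_iff_of_nonneg hnn').1 h0 B hB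
      have := (div_eq_zero_iff.1 this).resolve_right (hpos B hB).ne'
      have : deficit E l B * (l - deficit E l B) = 0 := by exact_mod_cast this
      rcases mul_eq_zero.1 this with h | h
      · exact .inl h
      · exact .inr (by omega)) hsum
  refine hL.isType1_of_card_eq (by omega) hA fun B hB hBA => ?_
  have := H.card_eq hB
  rw [h B hB hBA] at this
  omega

/-- Here `v = 7`, so a single point lies outside `E`; every deficit is `-1` and all blocks have
equal size. -/
theorem false_of_index_eq_three (H : HasIntegralRatio L v 3 2 2 E) (hL : IsRyserDesign L v 3)
    (hE : E.card = 6) : False := by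
  have hv := H.order_eq
  have hd : ∀ B ∈ L, deficit E 3 B = -1 := fun B hB => by
    have h1 := H.neg_one_le_deficit rfl B hB
    have h2 := H.card_sdiff_le hL B
    rw [H.card_sdiff_eq hB] at h2
    omega
  obtain ⟨B₁, hB₁, B₂, hB₂, hne⟩ := hL.exists_card_ne
  have h1 := H.card_eq hB₁
  have h2 := H.card_eq hB₂
  rw [hd _ hB₁] at h1
  rw [hd _ hB₂] at h2
  omega

theorem isType1_of_ratio_add_one_eq (H : HasIntegralRatio L v l n g E) (hL : IsRyserDesign L v l)
    (hv : v ≤ l ^ 2 + l + 1) (hn : l = n + 1) : IsType1 L := by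
  have hn2 := H.one_lt_ratio
  have hg0 := H.pos
  have hvg : v = 1 + l * g := by rw [H.order_eq, hn]
  have hgl : g ≤ l + 1 := by nlinarith
  have he := H.card_mul hL
  have hlt := H.card_lt hL
  obtain rfl : n = l - 1 := by omega
  have hnz : ((l - 1 : ℕ) : ℤ) = l - 1 := by omega
  rw [hnz] at he
  have hl3 : 3 ≤ l := by omega
  have ht : ((l : ℤ) + 2 - E.card) * (l - 2) = g - 3 := by linear_combination -he
  obtain ⟨t, ht'⟩ : ∃ t : ℤ, t = (l : ℤ) + 2 - E.card := ⟨_, rfl⟩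
  rw [← ht'] at ht
  have hl3z : (3 : ℤ) ≤ l := by exact_mod_cast hl3
  have hglz : (g : ℤ) ≤ l + 1 := by exact_mod_cast hgl
  have hg0z : (0 : ℤ) < g := by exact_mod_cast hg0
  have hvgz : (v : ℤ) = 1 + l * g := by exact_mod_cast hvg
  have ht1 : t ≤ 1 := by
    by_contra! h
    nlinarith
  have ht2 : -2 ≤ t := by
    by_contra! h
    nlinarith
  -- The values are `t = -2, -1, 0, 1`. For `(l, g) = (3, 1)` and `(4, 1)` the set `E` would have
  -- more than `v` points.
  interval_cases t
  · obtain rfl : l = 3 := by omega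
    omega
  · obtain rfl | rfl : l = 3 ∨ l = 4 := by omega
    · obtain rfl : g = 2 := by omega
      exact (H.false_of_index_eq_three hL (by omega)).elim
    · omega
  · exact (H.false_of_eq_three hL hn (by omega) (by omega)).elim
  · exact H.isType1_of_card_eq_succ hL hn (by omega) (by omega)

end HasIntegralRatio

end RatioAddOne

/-! ### Positivity of the index and the main theorem. -/

theorem IsRyserDesign.index_pos {X : Type*} [Fintype X] [DecidableEq X] {L : Finset (Finset X)}
    {v l : ℕ} (hL : IsRyserDesign L v l) (hv : v ≤ l ^ 2 + l + 1) : 0 < l := by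
  obtain ⟨B₁, hB₁, B₂, hB₂, hne⟩ := hL.exists_card_ne
  have h : 1 < L.card := Finset.one_lt_card.2 ⟨B₁, hB₁, B₂, hB₂, fun h => hne (by rw [h])⟩
  rw [hL.card_blocks] at h
  rcases Nat.eq_zero_or_pos l with rfl | hl
  · omega
  · exact hl

theorem mainTheorem5 {X : Type*} [Fintype X] [DecidableEq X] (L : Finset (Finset X)) (v l : ℕ)
    (hL : IsRyserDesign L v l) (hv : v ≤ l ^ 2 + l + 1)
    (hrho : rho L = (l : ℚ) ∨ rho L = (l : ℚ) - 1) :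
    IsType1 L := by
  have hl := hL.index_pos hv
  rcases hrho with h | h
  · obtain ⟨g, E, H⟩ := hL.exists_hasIntegralRatio hl h
    exact H.isType1_of_ratio_eq hL hv rfl
  · obtain ⟨n, rfl⟩ : ∃ n, l = n + 1 := ⟨l - 1, by omega⟩
    obtain ⟨g, E, H⟩ := hL.exists_hasIntegralRatio (n := n) hl (by rw [h]; push_cast; ring)
    exact H.isType1_of_ratio_add_one_eq hL hv rfl
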